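/- Let $R$ be a ring with $1\neq 0$, let $M$ be a right $R$-module that is faithfully projective (i.e. a sequence $A\to B\to C$ of right $R$-modules is exact if and only if $\mathrm{Hom}_R(M,A)\to\mathrm{Hom}_R(M,B)\to\mathrm{Hom}_R(M,C)$ is exact), and suppose that the ring $\mathrm{End}_R(M)$ is right Artinian. Call a module local if it has a largest proper submodule, indecomposable if it is nonzero and its endomorphism ring has no idempotents other than $0$ and $1$, and strongly indecomposable if its endomorphism ring is local; call an idempotent $e\in R$ local if the right module $eR$ is local. Then: 1. $M$ has finite length. 2. There are positive integers $k,n_1,\dots,n_k$, pairwise nonisomorphic submodules $M_1,\dots,M_k$ of $M$, and local idempotents $e_1,\dots,e_k$ of $R$ such that each $M_i$ is local, projective and strongly indecomposable, $M_i\cong e_iR$ for every $i$ (so each $e_iR$ is local, projective and strongly indecomposable as well), and $$M\cong M_1^{n_1}\oplus\cdots\oplus M_k^{n_k}\cong (e_1R)^{n_1}\oplus\cdots\oplus(e_kR)^{n_k}.$$ 3. These decompositions are unique: if $M\cong L_1^{n_1}\oplus\cdots\oplus L_k^{n_k}$ and $M\cong {L'_1}^{m_1}\oplus\cdots\oplus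 {L'_l}^{m_l}$, where $L_1,\dots,L_k$ are pairwise nonisomorphic indecomposable right $R$-modules, $L'_1,\dots,L'_l$ are pairwise nonisomorphic indecomposable right $R$-modules, and all $n_i,m_j$ are positive integers, then $k=l$ and there is a bijection $\sigma$ from $\{1,\dots,k\}$ to $\{1,\dots,l\}$ with $L_i\cong L'_{\sigma(i)}$ and $n_i=m_{\sigma(i)}$ for all $i$. In particular this applies to decompositions as in 2. -/

import Mathlib

universe u v w w'

/-! A right module over a ring `R` is a module over the opposite ring `Rᵐᵒᵖ`, as usual in Mathlib.
The notions for modules are defined over an arbitrary ring `S` and are applied to `S = Rᵐᵒᵖ`. -/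

section Modules

variable (S : Type u) [Ring S] (M : Type v) [AddCommGroup M] [Module S M]

/-- `M` is faithfully projective: the functor `Hom_S(M, -)` is faithfully exact, that is, a sequence
`A → B → C` of modules is exact at `B` if and only if the induced sequence
`Hom(M, A) → Hom(M, B) → Hom(M, C)` is exact at `Hom(M, B)`. -/
def IsFaithfullyProjective : Prop :=
  ∀ (A B C : Type (max u v)) [AddCommGroup A] [AddCommGroup B] [AddCommGroup C]
    [Module S A] [Module S B] [Module S C] (f : A →ₗ[S] B) (g : B →ₗ[S] C),
    Function.Exact f g ↔
      Function.Exact (fun h : M →ₗ[S] A => f ∘ₗ h) (fun h : M →ₗ[S] B => g ∘ₗ h)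

/-- `M` is a local module: it has a largest proper submodule. In particular `M ≠ 0`. -/
def IsLocalModule : Prop :=
  ∃ N : Submodule S M, IsGreatest {K : Submodule S M | K ≠ ⊤} N

/-- `M` is indecomposable: it is nonzero and its endomorphism ring has no idempotents other than
`0` and `1`. -/
def IsIndecomposableModule : Prop :=
  Nontrivial M ∧ ∀ p : Module.End S M, IsIdempotentElem p → p = 0 ∨ p = 1

/-- `M` is strongly indecomposable: its endomorphism ring is local. -/
def IsStronglyIndecomposable : Prop :=
  IsLocalRing (Module.End S M)

/-- `M ≅ L₁^{n₁} ⊕ ⋯ ⊕ L_k^{n_k}`, where the `L_i` are pairwise nonisomorphic and the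
multiplicities `n_i` are positive. -/
def IsDirectSumWithMultiplicities {k : ℕ} (n : Fin k → ℕ) (L : Fin k → Type w)
    [∀ i, AddCommGroup (L i)] [∀ i, Module S (L i)] : Prop :=
  (∀ i, 0 < n i) ∧
  (∀ i j, i ≠ j → IsEmpty (L i ≃ₗ[S] L j)) ∧
  Nonempty (M ≃ₗ[S] ((i : Fin k) → Fin (n i) → L i))

end Modules

section Idempotents

variable {R : Type u} [Ring R]

/-- The right ideal `eR` of `R`, as a right `R`-module. -/
def principalRightIdeal (e : R) : Submodule Rᵐᵒᵖ R :=
  Submodule.span Rᵐᵒᵖ {e}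

theorem mem_principalRightIdeal (e x : R) : x ∈ principalRightIdeal e ↔ ∃ r : R, e * r = x := by
  unfold principalRightIdeal
  rw [Submodule.mem_span_singleton]
  exact ⟨fun ⟨a, h⟩ => ⟨a.unop, h⟩, fun ⟨r, h⟩ => ⟨MulOpposite.op r, h⟩⟩

/-- `e` is a local idempotent: `e² = e` and the right module `eR` is local. -/
def IsLocalIdempotent (e : R) : Prop :=
  IsIdempotentElem e ∧ IsLocalModule Rᵐᵒᵖ (principalRightIdeal e)

end Idempotents

/-! ### Modules with local endomorphism ring, and multiplicities. -/

section Indecomposable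

variable {S : Type*} [Ring S] {M N X Y : Type*} [AddCommGroup M] [Module S M]
  [AddCommGroup N] [Module S N] [AddCommGroup X] [Module S X] [AddCommGroup Y] [Module S Y]

/-! Sending a submodule `K` to the right ideal of endomorphisms with image in `K` is strictly
monotone, because faithful exactness detects whether an inclusion is onto (`strictMono_endInto`). So
both chain conditions descend from the endomorphism ring to `M`. Splitting off idempotents gives
indecomposable summands, with local endomorphism rings by Fitting. They are finitely generated
projective, hence local, hence cyclic, hence of the form `eR`.

For uniqueness, the multiplicity of `X` is read off from `M` alone as the length of `Hom(X, M)`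
modulo the maps that are not split monomorphisms. This is additive, equal to 1 on copies of `X` and
0 on other indecomposables. -/

theorem Ring.isUnit_or_isUnit_one_sub (A : Type*) [Ring A] [IsLocalRing A] (a : A) :
    IsUnit a ∨ IsUnit (1 - a) :=
  IsLocalRing.isUnit_or_isUnit_of_add_one (by simp)

theorem Ring.isLocalRing_of_isUnit_or_isUnit_one_sub {A : Type*} [Ring A] [Nontrivial A]
    (h : ∀ a : A, IsUnit a ∨ IsUnit (1 - a)) : IsLocalRing A where
  isUnit_or_isUnit_of_add_one {a b} hab := by
    rw [← eq_sub_iff_add_eq'] at hab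
    exact hab ▸ h a

theorem IsIndecomposableModule.eq_bot_or_eq_bot (h : IsIndecomposableModule S M)
    {p q : Submodule S M} (hpq : IsCompl p q) : p = ⊥ ∨ q = ⊥ := by
  have hi : IsIdempotentElem (p.projection q hpq) := Submodule.isIdempotentElem_projection hpq
  rcases h.2 _ hi with h0 | h1
  · left
    rw [← Submodule.range_projection hpq, h0, LinearMap.range_zero]
  · right
    rw [← Submodule.ker_projection hpq, h1]
    exact LinearMap.ker_id

/-- Fitting's lemma. -/
theorem IsIndecomposableModule.isStronglyIndecomposable [IsNoetherian S M] [IsArtinian S M]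
    (h : IsIndecomposableModule S M) : IsStronglyIndecomposable S M := by
  have := h.1
  refine Ring.isLocalRing_of_isUnit_or_isUnit_one_sub fun a => ?_
  obtain ⟨n, hn, hn0⟩ :=
    (a.eventually_isCompl_ker_pow_range_pow.and (Filter.eventually_ne_atTop 0)).exists
  rcases h.eq_bot_or_eq_bot hn with hk | hr
  · left
    rw [← isUnit_pow_iff hn0, Module.End.isUnit_iff]
    exact IsArtinian.bijective_of_injective_endomorphism _ (LinearMap.ker_eq_bot.mp hk)
  · right
    exact IsNilpotent.isUnit_one_sub ⟨n, LinearMap.range_eq_bot.mp hr⟩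

theorem RingEquiv.isLocalRing_of_ring {A B : Type*} [Ring A] [Ring B] [IsLocalRing A]
    (e : A ≃+* B) : IsLocalRing B := by
  have : Nontrivial B := e.injective.nontrivial
  refine Ring.isLocalRing_of_isUnit_or_isUnit_one_sub fun b => ?_
  rcases Ring.isUnit_or_isUnit_one_sub _ (e.symm b) with h | h
  · left; simpa using h.map e
  · right; simpa using h.map e

theorem IsStronglyIndecomposable.of_equiv (e : M ≃ₗ[S] N) (h : IsStronglyIndecomposable S M) :
    IsStronglyIndecomposable S N :=
  have : IsLocalRing (Module.End S M) := h
  RingEquiv.isLocalRing_of_ring e.conjRingEquiv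

theorem IsLocalModule.of_equiv (e : M ≃ₗ[S] N) (h : IsLocalModule S M) : IsLocalModule S N := by
  obtain ⟨K, hK, hmax⟩ := h
  let o := Submodule.orderIsoMapComap e
  refine ⟨o K, ?_, fun L hL => ?_⟩
  · simpa using hK
  · have : o.symm L ≤ K := hmax (by simpa using hL)
    simpa using o.monotone this

theorem IsLocalRing.idempotent_eq_zero_or_one {A : Type*} [Ring A] [IsLocalRing A] {p : A}
    (hp : IsIdempotentElem p) : p = 0 ∨ p = 1 := by
  rcases Ring.isUnit_or_isUnit_one_sub _ p with h | h
  · right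
    exact h.mul_left_cancel (by rw [hp.eq, mul_one])
  · left
    have := hp.one_sub
    have h1 : 1 - p = 1 := h.mul_left_cancel (by rw [this.eq, mul_one])
    simpa using h1

/-- A module map out of a module with local endomorphism ring that is a split monomorphism
into an indecomposable module is an isomorphism. -/
theorem IsIndecomposableModule.bijective_of_isUnit_comp [Nontrivial X]
    (hY : IsIndecomposableModule S Y) {f : X →ₗ[S] Y} {g : Y →ₗ[S] X}
    (h : IsUnit (g ∘ₗ f : Module.End S X)) : Function.Bijective f := by
  have hb : Function.Bijective (g ∘ₗ f) := (Module.End.isUnit_iff _).mp h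
  have hinj : Function.Injective f := Function.Injective.of_comp (f := g) (by simpa using hb.1)
  refine ⟨hinj, ?_⟩
  let u := LinearEquiv.ofBijective _ hb
  have hu : ∀ x, u.symm (g (f x)) = x := fun x => u.symm_apply_apply x
  -- The projection of `Y` onto the image of `f`.
  let p : Module.End S Y := f ∘ₗ u.symm.toLinearMap ∘ₗ g
  have hp : ∀ y, p y = f (u.symm (g y)) := fun _ => rfl
  have hi : IsIdempotentElem p := by
    ext y
    simp [hp, hu]
  rcases hY.2 p hi with h0 | h1
  · obtain ⟨x, hx⟩ := exists_ne (0 : X)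
    refine absurd ?_ hx
    have := congrArg (fun q => q (f x)) h0
    simp only [hp, hu, LinearMap.zero_apply] at this
    exact (map_eq_zero_iff f hinj).mp this
  · intro y
    exact ⟨u.symm (g y), by rw [← hp, h1]; rfl⟩

/-- `Hom(X, M)` is a right module over the endomorphism ring of `X`. -/
@[reducible] def LinearMap.moduleEndMulOpposite (S : Type*) [Ring S]
    (X : Type*) [AddCommGroup X] [Module S X] (M : Type*) [AddCommGroup M] [Module S M] :
    Module (Module.End S X)ᵐᵒᵖ (X →ₗ[S] M) where
  smul a f := f ∘ₗ a.unop
  one_smul _ := rfl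
  mul_smul _ _ _ := rfl
  smul_zero _ := LinearMap.zero_comp _
  smul_add _ _ _ := LinearMap.add_comp _ _ _
  add_smul _ _ _ := LinearMap.comp_add _ _ _
  zero_smul _ := LinearMap.comp_zero _

attribute [local instance] LinearMap.moduleEndMulOpposite

/-- The radical of `Hom(X, M)`, for a module `X` with local endomorphism ring: the maps that are
not split monomorphisms. It is a submodule for the action of the endomorphism ring of `X`. -/
def homRadical (S : Type*) [Ring S] (X : Type*) [AddCommGroup X] [Module S X]
    [IsLocalRing (Module.End S X)] (M : Type*) [AddCommGroup M] [Module S M] :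
    Submodule (Module.End S X)ᵐᵒᵖ (X →ₗ[S] M) where
  carrier := {f | ∀ g : M →ₗ[S] X, ¬ IsUnit (g ∘ₗ f : Module.End S X)}
  zero_mem' g := by
    simp only [LinearMap.comp_zero]
    exact not_isUnit_zero
  add_mem' {f₁ f₂} h₁ h₂ g := by
    rw [LinearMap.comp_add]
    exact IsLocalRing.nonunits_add (h₁ g) (h₂ g)
  smul_mem' a f hf := by
    obtain ⟨a, rfl⟩ := MulOpposite.op_surjective a
    intro g hg
    let b : Module.End S X := g ∘ₗ f
    have hg' : IsUnit (b * a) := hg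
    obtain ⟨c, hc⟩ := hg'.exists_right_inv
    obtain ⟨c', hc'⟩ := hg'.exists_left_inv
    have hcc : c' = c := left_inv_eq_right_inv hc' hc
    subst hcc
    -- With `c'` inverse to `b * a`, this idempotent is 0 or 1. It is not 0, so `a ∘ c' ∘ g` is a
    -- left inverse of `f`.
    have hi : IsIdempotentElem (a * c' * b) := by
      calc a * c' * b * (a * c' * b) = a * (c' * (b * a)) * c' * b := by noncomm_ring
        _ = a * c' * b := by rw [hc', mul_one]
    refine hf (a ∘ₗ c' ∘ₗ g) ?_
    change IsUnit (a * c' * b)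
    rcases IsLocalRing.idempotent_eq_zero_or_one hi with h0 | h1
    · have : (1 : Module.End S X) = 0 := by
        calc (1 : Module.End S X) = (b * a * c') * (b * a * c') := by rw [hc, mul_one]
          _ = b * (a * c' * b) * (a * c') := by noncomm_ring
          _ = 0 := by rw [h0, mul_zero, zero_mul]
      exact absurd this one_ne_zero
    · rw [h1]; exact isUnit_one

/-- The multiplicity of `X` in `M`. -/
noncomputable def homLength (S : Type*) [Ring S] (X : Type*) [AddCommGroup X] [Module S X]
    [IsLocalRing (Module.End S X)] (M : Type*) [AddCommGroup M] [Module S M] : ℕ∞ :=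
  Module.length (Module.End S X)ᵐᵒᵖ ((X →ₗ[S] M) ⧸ homRadical S X M)

variable [IsLocalRing (Module.End S X)]

theorem homLength_congr (e : M ≃ₗ[S] N) : homLength S X M = homLength S X N := by
  let E : (X →ₗ[S] M) ≃ₗ[(Module.End S X)ᵐᵒᵖ] (X →ₗ[S] N) :=
    { toFun := fun f => e.toLinearMap ∘ₗ f
      invFun := fun f => e.symm.toLinearMap ∘ₗ f
      map_add' := fun f g => by ext; simp
      map_smul' := fun a f => rfl
      left_inv := fun f => by ext; simp
      right_inv := fun f => by ext; simp }
  refine (Submodule.Quotient.equiv _ _ E ?_).length_eq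
  ext f
  constructor
  · rintro ⟨f, hf, rfl⟩ g
    exact hf (g ∘ₗ e.toLinearMap)
  · intro hf
    refine ⟨E.symm f, fun g hg => hf (g ∘ₗ e.symm.toLinearMap) hg, E.apply_symm_apply f⟩

/-- A composite through the product is the sum of its parts through the factors, and in a local ring
a sum is a unit only if some summand is. -/
theorem mem_homRadical_pi_iff {ι : Type*} [Fintype ι] {Y : ι → Type*} [∀ i, AddCommGroup (Y i)]
    [∀ i, Module S (Y i)] {f : X →ₗ[S] ∀ i, Y i} :
    f ∈ homRadical S X (∀ i, Y i) ↔ ∀ i, LinearMap.proj i ∘ₗ f ∈ homRadical S X (Y i) := by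
  classical
  refine ⟨fun hf i g => hf (g ∘ₗ LinearMap.proj i), fun hf g hg => ?_⟩
  have hsum : (g ∘ₗ f : Module.End S X) =
      ∑ i, ((g ∘ₗ LinearMap.single S Y i) ∘ₗ LinearMap.proj i ∘ₗ f : Module.End S X) := by
    ext x
    have hx : f x = ∑ i, LinearMap.single S Y i (f x i) := by
      simp [Finset.univ_sum_single]
    rw [LinearMap.comp_apply, hx]
    simp [LinearMap.sum_apply]
  rw [hsum] at hg
  obtain ⟨i, -, hi⟩ := IsLocalRing.exists_of_isUnit_sum hg
  exact hf i _ hi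

theorem homLength_pi {ι : Type*} [Fintype ι] (Y : ι → Type*) [∀ i, AddCommGroup (Y i)]
    [∀ i, Module S (Y i)] : homLength S X (∀ i, Y i) = ∑ i, homLength S X (Y i) := by
  let Φ : (X →ₗ[S] ∀ i, Y i) →ₗ[(Module.End S X)ᵐᵒᵖ]
      ∀ i, (X →ₗ[S] Y i) ⧸ homRadical S X (Y i) :=
    { toFun := fun f i => Submodule.Quotient.mk (LinearMap.proj i ∘ₗ f)
      map_add' := fun f g => rfl
      map_smul' := fun a f => rfl }
  have hsurj : Function.Surjective Φ := by
    intro y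
    choose f hf using fun i => Submodule.Quotient.mk_surjective _ (y i)
    exact ⟨LinearMap.pi f, funext hf⟩
  have hker : homRadical S X (∀ i, Y i) = LinearMap.ker Φ := by
    ext f
    rw [mem_homRadical_pi_iff, LinearMap.mem_ker, funext_iff]
    exact forall_congr' fun i => (Submodule.Quotient.mk_eq_zero _).symm
  exact ((Submodule.quotEquivOfEq _ _ hker).trans
    (Φ.quotKerEquivOfSurjective hsurj)).length_eq.trans (Module.length_pi_of_fintype ..)

/-- A map `f` outside the radical is an isomorphism, so every `h` equals `f ∘ (f⁻¹ ∘ h)`: the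
radical is a maximal submodule. -/
theorem homLength_eq_one [Nontrivial X] (hY : IsIndecomposableModule S Y) (e : X ≃ₗ[S] Y) :
    homLength S X Y = 1 := by
  rw [homLength, Module.length_eq_one_iff, isSimpleModule_iff_isCoatom]
  constructor
  · intro h
    have he : e.toLinearMap ∈ homRadical S X Y := h ▸ Submodule.mem_top
    refine he e.symm.toLinearMap ?_
    rw [LinearEquiv.symm_comp]
    exact isUnit_one
  · intro K hK
    obtain ⟨f, hfK, hf⟩ := Set.exists_of_ssubset hK
    rw [eq_top_iff]
    intro h _
    have : ∃ g : Y →ₗ[S] X, IsUnit (g ∘ₗ f : Module.End S X) := by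
      by_contra! h
      exact hf h
    obtain ⟨g, hg⟩ := this
    let u := LinearEquiv.ofBijective f (hY.bijective_of_isUnit_comp hg)
    have := K.smul_mem (MulOpposite.op (u.symm.toLinearMap ∘ₗ h : Module.End S X)) hfK
    convert this using 1
    ext x
    exact (u.apply_symm_apply (h x)).symm

theorem homLength_eq_zero [Nontrivial X] (hY : IsIndecomposableModule S Y)
    (e : IsEmpty (X ≃ₗ[S] Y)) : homLength S X Y = 0 := by
  rw [homLength, Module.length_eq_zero_iff, Submodule.Quotient.subsingleton_iff,
    eq_top_iff]
  intro f _ g hg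
  exact e.elim (LinearEquiv.ofBijective f (hY.bijective_of_isUnit_comp hg))

end Indecomposable

/-! ### The Krull–Schmidt theorem. -/

section KrullSchmidt

variable {S : Type*} [Ring S] {M : Type*} [AddCommGroup M] [Module S M]

theorem IsDirectSumWithMultiplicities.homLength_eq {k : ℕ} {n : Fin k → ℕ} {L : Fin k → Type*}
    [∀ i, AddCommGroup (L i)] [∀ i, Module S (L i)]
    (h : IsDirectSumWithMultiplicities S M n L) (X : Type*) [AddCommGroup X] [Module S X]
    [IsLocalRing (Module.End S X)] :
    homLength S X M = ∑ i, n i * homLength S X (L i) := by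
  obtain ⟨-, -, ⟨e⟩⟩ := h
  simp [homLength_congr e, homLength_pi]

theorem IsDirectSumWithMultiplicities.finiteLength {k : ℕ} {n : Fin k → ℕ} {L : Fin k → Type*}
    [∀ i, AddCommGroup (L i)] [∀ i, Module S (L i)] [IsNoetherian S M] [IsArtinian S M]
    (h : IsDirectSumWithMultiplicities S M n L) (i : Fin k) :
    IsNoetherian S (L i) ∧ IsArtinian S (L i) := by
  obtain ⟨hn, -, ⟨e⟩⟩ := h
  let p : M →ₗ[S] L i := LinearMap.proj (⟨0, hn i⟩ : Fin (n i)) ∘ₗ LinearMap.proj i ∘ₗ e.toLinearMap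
  have hp : Function.Surjective p := by
    intro x
    obtain ⟨y, hy⟩ := e.surjective (fun j _ => if h : i = j then h ▸ x else 0)
    refine ⟨y, ?_⟩
    simp [p, hy]
  exact ⟨isNoetherian_of_surjective p (LinearMap.range_eq_top.mpr hp),
    isArtinian_of_surjective M p hp⟩

/-- The multiplicity of `L i` in `M` is `n i > 0` by the first decomposition; by the second it is `m
j` if `L' j ≅ L i`, and 0 if no such `j` exists. -/
theorem IsDirectSumWithMultiplicities.exists_equiv {k l : ℕ} {n : Fin k → ℕ} {m : Fin l → ℕ}
    {L : Fin k → Type*} {L' : Fin l → Type*}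
    [∀ i, AddCommGroup (L i)] [∀ i, Module S (L i)]
    [∀ i, AddCommGroup (L' i)] [∀ i, Module S (L' i)] [IsNoetherian S M] [IsArtinian S M]
    (hL : ∀ i, IsIndecomposableModule S (L i)) (hL' : ∀ j, IsIndecomposableModule S (L' j))
    (h : IsDirectSumWithMultiplicities S M n L) (h' : IsDirectSumWithMultiplicities S M m L')
    (i : Fin k) : ∃ j, m j = n i ∧ Nonempty (L i ≃ₗ[S] L' j) := by
  obtain ⟨_, _⟩ := h.finiteLength i
  have : IsLocalRing (Module.End S (L i)) := (hL i).isStronglyIndecomposable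
  have := (hL i).1
  have h1 : homLength S (L i) M = n i := by
    rw [h.homLength_eq, Finset.sum_eq_single i, homLength_eq_one (hL i) (LinearEquiv.refl S _),
      mul_one]
    · intro a _ ha
      rw [homLength_eq_zero (hL a) (h.2.1 i a ha.symm), mul_zero]
    · simp
  by_cases hj : ∃ j, Nonempty (L i ≃ₗ[S] L' j)
  · obtain ⟨j, ⟨e⟩⟩ := hj
    refine ⟨j, ?_, ⟨e⟩⟩
    have h2 : homLength S (L i) M = m j := by
      rw [h'.homLength_eq, Finset.sum_eq_single j, homLength_eq_one (hL' j) e, mul_one]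
      · intro a _ ha
        have : IsEmpty (L i ≃ₗ[S] L' a) := ⟨fun e' => (h'.2.1 a j ha).elim (e'.symm.trans e)⟩
        rw [homLength_eq_zero (hL' a) this, mul_zero]
      · simp
    exact_mod_cast h2.symm.trans h1
  · have h2 : homLength S (L i) M = 0 := by
      rw [h'.homLength_eq]
      refine Finset.sum_eq_zero fun a _ => ?_
      rw [homLength_eq_zero (hL' a) ⟨fun e => hj ⟨a, ⟨e⟩⟩⟩, mul_zero]
    have := h.1 i
    have h3 : (n i : ℕ∞) = 0 := h1.symm.trans h2
    have h4 : n i = 0 := by exact_mod_cast h3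
    omega

/-- Uniqueness in the Krull–Schmidt theorem. -/
theorem IsDirectSumWithMultiplicities.unique {k l : ℕ} {n : Fin k → ℕ} {m : Fin l → ℕ}
    {L : Fin k → Type*} {L' : Fin l → Type*}
    [∀ i, AddCommGroup (L i)] [∀ i, Module S (L i)]
    [∀ i, AddCommGroup (L' i)] [∀ i, Module S (L' i)] [IsNoetherian S M] [IsArtinian S M]
    (hL : ∀ i, IsIndecomposableModule S (L i)) (hL' : ∀ j, IsIndecomposableModule S (L' j))
    (h : IsDirectSumWithMultiplicities S M n L) (h' : IsDirectSumWithMultiplicities S M m L') :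
    ∃ σ : Fin k ≃ Fin l, ∀ i, m (σ i) = n i ∧ Nonempty (L i ≃ₗ[S] L' (σ i)) := by
  choose s hs hs' using fun i => exists_equiv hL hL' h h' i
  refine ⟨Equiv.ofBijective s ⟨fun a b hab => ?_, fun j => ?_⟩, fun i => ⟨hs i, hs' i⟩⟩
  · by_contra hne
    obtain ⟨f⟩ := hs' a
    obtain ⟨g⟩ := hs' b
    rw [← hab] at g
    exact (h.2.1 a b hne).elim (f.trans g.symm)
  · obtain ⟨i, -, ⟨f⟩⟩ := exists_equiv hL' hL h' h j
    obtain ⟨g⟩ := hs' i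
    refine ⟨i, ?_⟩
    by_contra hne
    exact (h'.2.1 _ _ hne).elim (g.symm.trans f.symm)

/-- A nontrivial idempotent splits `K` into its range and kernel, both strictly smaller. Inducting
over submodules of a fixed `M` makes the descending chain condition available. -/
theorem exists_indecomposable_decomposition_submodule [IsArtinian S M] (K : Submodule S M) :
    ∃ (ι : Type) (_ : Fintype ι) (N : ι → Submodule S M),
      (∀ i, IsIndecomposableModule S (N i)) ∧ Nonempty (K ≃ₗ[S] ∀ i, N i) := by
  induction K using WellFoundedLT.induction with
  | ind K ih =>
    by_cases hK : IsIndecomposableModule S K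
    · exact ⟨Unit, inferInstance, fun _ => K, fun _ => hK,
        ⟨(LinearEquiv.funUnique Unit S K).symm⟩⟩
    rcases subsingleton_or_nontrivial K with hs | hn
    · exact ⟨Empty, inferInstance, fun i => i.elim, fun i => i.elim, ⟨LinearEquiv.ofSubsingleton _ _⟩⟩
    have : ∃ p : Module.End S K, IsIdempotentElem p ∧ p ≠ 0 ∧ p ≠ 1 := by
      by_contra! h
      exact hK ⟨hn, fun p hp => or_iff_not_imp_left.mpr (h p hp)⟩
    obtain ⟨p, hp, hp0, hp1⟩ := this
    have hc : IsCompl (LinearMap.range p) (LinearMap.ker p) := LinearMap.IsIdempotentElem.isCompl hp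
    have hlt : ∀ A : Submodule S K, A ≠ ⊤ → A.map K.subtype < K := by
      intro A hA
      refine lt_of_le_of_ne (Submodule.map_subtype_le K A) fun h => hA ?_
      refine Submodule.map_injective_of_injective K.injective_subtype ?_
      rw [h, Submodule.map_subtype_top]
    have hr : LinearMap.range p ≠ ⊤ := by
      intro h
      apply hp1
      ext x
      obtain ⟨y, rfl⟩ := LinearMap.range_eq_top.mp h x
      exact congrArg (fun q => ((q y : K) : M)) hp.eq
    have hk : LinearMap.ker p ≠ ⊤ := fun h => hp0 (LinearMap.ker_eq_top.mp h)
    obtain ⟨ι₁, _, N₁, h₁, ⟨e₁⟩⟩ := ih _ (hlt _ hr)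
    obtain ⟨ι₂, _, N₂, h₂, ⟨e₂⟩⟩ := ih _ (hlt _ hk)
    refine ⟨ι₁ ⊕ ι₂, inferInstance, Sum.elim N₁ N₂, ?_, ⟨?_⟩⟩
    · rintro (i | i)
      · exact h₁ i
      · exact h₂ i
    · have f₁ := (Submodule.equivMapOfInjective _ K.injective_subtype _).trans e₁
      have f₂ := (Submodule.equivMapOfInjective _ K.injective_subtype _).trans e₂
      exact (Submodule.prodEquivOfIsCompl _ _ hc).symm.trans <| (f₁.prodCongr f₂).trans
        (LinearEquiv.sumPiEquivProdPi S ι₁ ι₂ fun i => (Sum.elim N₁ N₂ i : Submodule S M)).symm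

/-- Existence in the Krull–Schmidt theorem. -/
theorem exists_isDirectSumWithMultiplicities [IsArtinian S M] :
    ∃ (k : ℕ) (n : Fin k → ℕ) (N : Fin k → Submodule S M),
      (∀ i, IsIndecomposableModule S (N i)) ∧
      IsDirectSumWithMultiplicities S M n (fun i => N i) := by
  classical
  obtain ⟨ι, _, N, hN, ⟨e⟩⟩ := exists_indecomposable_decomposition_submodule (⊤ : Submodule S M)
  -- Summands are grouped by isomorphism class; the multiplicity is the size of the class.
  let r : Setoid ι :=
    { r := fun i j => Nonempty (N i ≃ₗ[S] N j)
      iseqv := ⟨fun i => ⟨LinearEquiv.refl S _⟩, fun ⟨f⟩ => ⟨f.symm⟩,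
        fun ⟨f⟩ ⟨g⟩ => ⟨f.trans g⟩⟩ }
  let q := Fintype.equivFin (Quotient r)
  let cls : ι → Fin (Fintype.card (Quotient r)) := fun i => q (Quotient.mk r i)
  let rep := fun a => (q.symm a).out
  have hrep : ∀ a, cls (rep a) = a := fun a => by simp [cls, rep]
  have hiso : ∀ i j, cls i = cls j ↔ Nonempty (N i ≃ₗ[S] N j) := fun i j => by
    rw [q.injective.eq_iff, Quotient.eq]
    rfl
  let n := fun a => Fintype.card {i // cls i = a}
  refine ⟨_, n, fun a => N (rep a), fun a => hN _, fun a => ?_, fun a b hab => ?_, ⟨?_⟩⟩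
  · exact Fintype.card_pos_iff.mpr ⟨⟨rep a, hrep a⟩⟩
  · rw [← not_nonempty_iff, ← hiso, hrep, hrep]
    exact hab
  · let f : (Σ a, Fin (n a)) ≃ ι :=
      (Equiv.sigmaCongrRight fun a => (Fintype.equivFin _).symm).trans (Equiv.sigmaFiberEquiv cls)
    have hf : ∀ s, Nonempty (N (f s) ≃ₗ[S] N (rep s.1)) := fun s => by
      rw [← hiso, hrep]
      exact ((Fintype.equivFin _).symm s.2).2
    have g := fun s => (hf s).some
    exact Submodule.topEquiv.symm.trans <| e.trans <|
      (LinearEquiv.piCongrLeft S (fun i => N i) f).symm.trans <|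
      (LinearEquiv.piCongrRight g).trans (LinearEquiv.piCurry S fun a (_ : Fin (n a)) => N (rep a))

end KrullSchmidt

/-! ### Local projective modules and idempotents. -/

section LocalProjective

variable {S : Type*} [Ring S] {M N : Type*} [AddCommGroup M] [Module S M]
  [AddCommGroup N] [Module S N]

/-- If a maximal `K` did not contain a proper `K'`, lifting the identity through `K ⊕ K' → M` would
write 1 as a sum of endomorphisms with images in `K` and `K'`. One of them is a unit, which is
absurd. -/
theorem IsStronglyIndecomposable.isLocalModule [Module.Projective S M] [Module.Finite S M]
    (h : IsStronglyIndecomposable S M) : IsLocalModule S M := by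
  have : IsLocalRing (Module.End S M) := h
  have : Nontrivial M := by
    by_contra hM
    rw [not_nontrivial_iff_subsingleton] at hM
    exact one_ne_zero (α := Module.End S M) (Subsingleton.elim _ _)
  obtain ⟨K, hK⟩ := IsCoatomic.exists_coatom (Submodule S M)
  refine ⟨K, hK.1, fun K' hK' => ?_⟩
  by_contra hle
  have hsup : K ⊔ K' = ⊤ := hK.2 _ (left_lt_sup.mpr hle)
  have hsurj : Function.Surjective (K.subtype.coprod K'.subtype) := by
    rw [← LinearMap.range_eq_top, LinearMap.range_coprod, Submodule.range_subtype,
      Submodule.range_subtype, hsup]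
  obtain ⟨s, hs⟩ := Module.projective_lifting_property _ LinearMap.id hsurj
  have hadd : (K.subtype ∘ₗ LinearMap.fst S K K' ∘ₗ s : Module.End S M) +
      (K'.subtype ∘ₗ LinearMap.snd S K K' ∘ₗ s : Module.End S M) = 1 := by
    ext x
    exact LinearMap.congr_fun hs x
  have key : ∀ (A : Submodule S M) (f : M →ₗ[S] A),
      IsUnit (A.subtype ∘ₗ f : Module.End S M) → A = ⊤ := by
    intro A f hf
    rw [eq_top_iff]
    intro x _
    obtain ⟨y, rfl⟩ := ((Module.End.isUnit_iff _).mp hf).2 x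
    exact (f y).2
  rcases IsLocalRing.isUnit_or_isUnit_of_add_one hadd with hu | hu
  · exact hK.1 (key _ _ hu)
  · exact hK' (key _ _ hu)

/-- A ring is isomorphic, as a right module over itself, to its opposite. -/
def opSelfEquiv (A : Type*) [Ring A] : A ≃ₗ[Aᵐᵒᵖ] Aᵐᵒᵖ where
  toFun := MulOpposite.op
  invFun := MulOpposite.unop
  map_add' _ _ := rfl
  map_smul' _ _ := rfl
  left_inv _ := rfl
  right_inv _ := rfl

/-- An element `x` outside the largest proper submodule generates `P`. A section `s` of `R → P` then
embeds `P` as `s(x)R`, with `s(x)` idempotent. -/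
theorem IsLocalModule.exists_equiv_principalRightIdeal {R P : Type*} [Ring R] [AddCommGroup P]
    [Module Rᵐᵒᵖ P] [Module.Projective Rᵐᵒᵖ P] (h : IsLocalModule Rᵐᵒᵖ P) :
    ∃ e : R, IsIdempotentElem e ∧ Nonempty (P ≃ₗ[Rᵐᵒᵖ] principalRightIdeal e) := by
  obtain ⟨K, hK, hmax⟩ := h
  obtain ⟨x, -, hx⟩ := SetLike.exists_of_lt (lt_top_iff_ne_top.mpr hK)
  let φ : R →ₗ[Rᵐᵒᵖ] P := LinearMap.toSpanSingleton Rᵐᵒᵖ P x ∘ₗ (opSelfEquiv R).toLinearMap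
  have hφ : ∀ r, φ r = MulOpposite.op r • x := fun _ => rfl
  have hsurj : Function.Surjective φ := by
    rw [← LinearMap.range_eq_top]
    by_contra hne
    refine hx (hmax hne ⟨1, ?_⟩)
    rw [hφ, MulOpposite.op_one, one_smul]
  obtain ⟨s, hs⟩ := Module.projective_lifting_property φ LinearMap.id hsurj
  have hs' : ∀ y, φ (s y) = y := LinearMap.congr_fun hs
  have hmul : ∀ r, s x * r = s (φ r) := fun r => by
    rw [hφ, map_smul]
    rfl
  have hrange : LinearMap.range s = principalRightIdeal (s x) := by
    ext y
    rw [mem_principalRightIdeal]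
    constructor
    · rintro ⟨z, rfl⟩
      exact ⟨s z, by rw [hmul, hs']⟩
    · rintro ⟨r, rfl⟩
      exact ⟨φ r, (hmul r).symm⟩
  refine ⟨s x, ?_, ⟨(LinearEquiv.ofInjective s (Function.LeftInverse.injective hs')).trans
    (LinearEquiv.ofEq _ _ hrange)⟩⟩
  rw [IsIdempotentElem, hmul, hs']

theorem IsDirectSumWithMultiplicities.congr {k : ℕ} {n : Fin k → ℕ} {L : Fin k → Type*}
    {L' : Fin k → Type*} [∀ i, AddCommGroup (L i)] [∀ i, Module S (L i)]
    [∀ i, AddCommGroup (L' i)] [∀ i, Module S (L' i)]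
    (h : IsDirectSumWithMultiplicities S M n L) (e : ∀ i, L i ≃ₗ[S] L' i) :
    IsDirectSumWithMultiplicities S M n L' := by
  obtain ⟨hn, hne, ⟨f⟩⟩ := h
  exact ⟨hn, fun i j hij => ⟨fun g => (hne i j hij).elim ((e i).trans (g.trans (e j).symm))⟩,
    ⟨f.trans (LinearEquiv.piCongrRight fun i => LinearEquiv.piCongrRight fun _ => e i)⟩⟩

theorem IsDirectSumWithMultiplicities.projective {k : ℕ} {n : Fin k → ℕ} {L : Fin k → Type*}
    [∀ i, AddCommGroup (L i)] [∀ i, Module S (L i)] [Module.Projective S M]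
    (h : IsDirectSumWithMultiplicities S M n L) (i : Fin k) : Module.Projective S (L i) := by
  obtain ⟨hn, -, ⟨e⟩⟩ := h
  refine Module.Projective.of_split
    (e.symm.toLinearMap ∘ₗ LinearMap.single S (fun i => Fin (n i) → L i) i ∘ₗ
      LinearMap.single S (fun _ => L i) ⟨0, hn i⟩)
    (LinearMap.proj (⟨0, hn i⟩ : Fin (n i)) ∘ₗ LinearMap.proj i ∘ₗ e.toLinearMap) ?_
  ext x
  simp

end LocalProjective

/-! ### Chain conditions for faithfully projective modules. -/

section FaithfullyProjective

variable {S : Type u} [Ring S] {M : Type v} [AddCommGroup M] [Module S M]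

theorem IsFaithfullyProjective.projective (h : IsFaithfullyProjective S M) :
    Module.Projective S M := by
  refine Module.Projective.of_lifting_property'' fun f hf => ?_
  -- Test modules live in `Type (max u v)`, hence the lift.
  let u : ULift.{u} M ≃ₗ[S] M := ULift.moduleEquiv
  have hex : Function.Exact (u.symm.toLinearMap ∘ₗ f) (0 : ULift.{u} M →ₗ[S] PUnit.{max u v + 1}) := by
    intro y
    refine ⟨fun _ => ?_, fun _ => rfl⟩
    obtain ⟨x, hx⟩ := hf (u y)
    exact ⟨x, by simp [hx]⟩
  obtain ⟨g, hg⟩ := ((h _ _ _ _ _).mp hex u.symm.toLinearMap).mp (LinearMap.zero_comp _)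
  refine ⟨g, ?_⟩
  ext x
  have := LinearMap.congr_fun hg x
  exact u.symm.injective this

/-- If `M` were zero, all Hom sequences would be exact, hence so would `0 → S → 0`. -/
theorem IsFaithfullyProjective.nontrivial [Nontrivial S] (h : IsFaithfullyProjective S M) :
    Nontrivial M := by
  by_contra hM
  rw [not_nontrivial_iff_subsingleton] at hM
  have hex := (h PUnit (ULift.{v} S) PUnit 0 0).mpr fun g =>
    ⟨fun _ => ⟨0, Subsingleton.elim _ _⟩, fun _ => Subsingleton.elim _ _⟩
  obtain ⟨x, hx⟩ := (hex (ULift.up 1)).mp rfl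
  exact zero_ne_one (congrArg ULift.down hx)

/-- The right ideal of endomorphisms with image in a given submodule. -/
def Submodule.endInto (K : Submodule S M) :
    Submodule (Module.End S M)ᵐᵒᵖ (Module.End S M) where
  carrier := {f | ∀ x, f x ∈ K}
  zero_mem' _ := K.zero_mem
  add_mem' hf hg x := K.add_mem (hf x) (hg x)
  smul_mem' a _ hf x := hf (a.unop x)

/-- If `A < B` gave the same right ideal, `Hom(M, A) → Hom(M, B)` would be onto, so `A → B → 0`
would be exact. -/
theorem IsFaithfullyProjective.strictMono_endInto (h : IsFaithfullyProjective S M) :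
    StrictMono (Submodule.endInto (S := S) (M := M)) := by
  have hmono : Monotone (Submodule.endInto (S := S) (M := M)) := fun K K' hK f hf x => hK (hf x)
  intro A B hAB
  refine lt_of_le_of_ne (hmono hAB.le) fun heq => ?_
  let a : ULift.{u} A ≃ₗ[S] A := ULift.moduleEquiv
  let b : ULift.{u} B ≃ₗ[S] B := ULift.moduleEquiv
  let i : ULift.{u} A →ₗ[S] ULift.{u} B :=
    b.symm.toLinearMap ∘ₗ Submodule.inclusion hAB.le ∘ₗ a.toLinearMap
  have hex := (h _ _ PUnit i 0).mpr fun g => by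
    refine ⟨fun _ => ?_, fun _ => LinearMap.zero_comp _⟩
    have hg : ∀ x, ((b (g x) : B) : M) ∈ A := by
      have : (B.subtype ∘ₗ b.toLinearMap ∘ₗ g : Module.End S M) ∈ B.endInto := fun x => (b (g x)).2
      rw [← heq] at this
      exact this
    exact ⟨a.symm.toLinearMap ∘ₗ (B.subtype ∘ₗ b.toLinearMap ∘ₗ g).codRestrict A hg, rfl⟩
  refine hAB.not_ge fun x hx => ?_
  obtain ⟨y, hy⟩ := (hex (b.symm ⟨x, hx⟩)).mp rfl
  have : Submodule.inclusion hAB.le (a y) = ⟨x, hx⟩ := b.symm.injective hy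
  have h2 := congrArg Subtype.val this
  simp only [Submodule.coe_inclusion] at h2
  rw [← h2]
  exact (a y).2

/-- Hopkins–Levitzki, transported from `Aᵐᵒᵖ` as a module over itself. -/
theorem isNoetherian_mulOpposite_of_isArtinian (A : Type*) [Ring A] [IsArtinian Aᵐᵒᵖ A] :
    IsNoetherian Aᵐᵒᵖ A := by
  have : IsArtinianRing Aᵐᵒᵖ := (opSelfEquiv A).isArtinian_iff.mp ‹_›
  exact isNoetherian_of_linearEquiv (opSelfEquiv A).symm

theorem IsFaithfullyProjective.isArtinian (h : IsFaithfullyProjective S M)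
    [IsArtinian (Module.End S M)ᵐᵒᵖ (Module.End S M)] : IsArtinian S M :=
  h.strictMono_endInto.wellFoundedLT

theorem IsFaithfullyProjective.isNoetherian (h : IsFaithfullyProjective S M)
    [IsArtinian (Module.End S M)ᵐᵒᵖ (Module.End S M)] : IsNoetherian S M := by
  have := isNoetherian_mulOpposite_of_isArtinian (Module.End S M)
  rw [isNoetherian_iff']
  exact h.strictMono_endInto.wellFoundedGT

end FaithfullyProjective

theorem theorem3p6 {R : Type u} [Ring R] [Nontrivial R]
    {M : Type v} [AddCommGroup M] [Module Rᵐᵒᵖ M]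
    (hM : IsFaithfullyProjective Rᵐᵒᵖ M)
    (hE : IsArtinian (Module.End Rᵐᵒᵖ M)ᵐᵒᵖ (Module.End Rᵐᵒᵖ M)) :
    -- finite length
    IsFiniteLength Rᵐᵒᵖ M ∧
    -- existence of the decompositions
    (∃ (k : ℕ) (n : Fin k → ℕ) (N : Fin k → Submodule Rᵐᵒᵖ M) (e : Fin k → R),
      0 < k ∧
      (∀ i, IsLocalModule Rᵐᵒᵖ (N i) ∧ Module.Projective Rᵐᵒᵖ (N i) ∧
        IsStronglyIndecomposable Rᵐᵒᵖ (N i)) ∧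
      IsDirectSumWithMultiplicities Rᵐᵒᵖ M n (fun i => N i) ∧
      (∀ i, IsLocalIdempotent (e i) ∧ Module.Projective Rᵐᵒᵖ (principalRightIdeal (e i)) ∧
        IsStronglyIndecomposable Rᵐᵒᵖ (principalRightIdeal (e i))) ∧
      (∀ i, Nonempty (N i ≃ₗ[Rᵐᵒᵖ] principalRightIdeal (e i))) ∧
      IsDirectSumWithMultiplicities Rᵐᵒᵖ M n (fun i => principalRightIdeal (e i))) ∧
    -- uniqueness, among all decompositions into indecomposable modules
    (∀ (k l : ℕ) (n : Fin k → ℕ) (m : Fin l → ℕ) (L : Fin k → Type w) (L' : Fin l → Type w')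
      [∀ i, AddCommGroup (L i)] [∀ i, Module Rᵐᵒᵖ (L i)]
      [∀ j, AddCommGroup (L' j)] [∀ j, Module Rᵐᵒᵖ (L' j)],
      (∀ i, IsIndecomposableModule Rᵐᵒᵖ (L i)) →
      (∀ j, IsIndecomposableModule Rᵐᵒᵖ (L' j)) →
      IsDirectSumWithMultiplicities Rᵐᵒᵖ M n L →
      IsDirectSumWithMultiplicities Rᵐᵒᵖ M m L' →
      ∃ σ : Fin k ≃ Fin l, ∀ i, m (σ i) = n i ∧ Nonempty (L i ≃ₗ[Rᵐᵒᵖ] L' (σ i))) := by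
  have hart := hM.isArtinian
  have hnoeth := hM.isNoetherian
  have hproj := hM.projective
  have hnt := hM.nontrivial
  refine ⟨isFiniteLength_iff_isNoetherian_isArtinian.mpr ⟨hnoeth, hart⟩, ?_,
    fun k l n m L L' _ _ _ _ hL hL' h h' => h.unique hL hL' h'⟩
  obtain ⟨k, n, N, hN, hsum⟩ := exists_isDirectSumWithMultiplicities (S := Rᵐᵒᵖ) (M := M)
  have hNproj : ∀ i, Module.Projective Rᵐᵒᵖ (N i) := hsum.projective
  have hNstrong : ∀ i, IsStronglyIndecomposable Rᵐᵒᵖ (N i) :=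
    fun i => (hN i).isStronglyIndecomposable
  have hNloc : ∀ i, IsLocalModule Rᵐᵒᵖ (N i) := fun i => (hNstrong i).isLocalModule
  choose e he hiso using fun i => (hNloc i).exists_equiv_principalRightIdeal
  refine ⟨k, n, N, e, ?_, fun i => ⟨hNloc i, hNproj i, hNstrong i⟩, hsum, fun i => ?_, hiso,
    hsum.congr fun i => (hiso i).some⟩
  · rw [Nat.pos_iff_ne_zero]
    rintro rfl
    obtain ⟨f⟩ := hsum.2.2
    exact not_subsingleton M f.injective.subsingleton
  · obtain ⟨f⟩ := hiso i
    exact ⟨⟨he i, (hNloc i).of_equiv f⟩, Module.Projective.of_equiv f, (hNstrong i).of_equiv f⟩
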